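/- Let $\mathbb K=\mathbb R$ or $\mathbb C$, and let $X,Y$ be Banach spaces over $\mathbb K$, where $Y$ has cotype $2$. Here the cotype $2$ constant $C_2(Y)$ is the least $C\ge 0$ such that $$\Big(\sum_{j=1}^N\|y_j\|^2\Big)^{1/2}\le C\Big(\mathbb E\Big\|\sum_{j=1}^N\varepsilon_j y_j\Big\|^2\Big)^{1/2}$$ for all $N$ and all $y_1,\dots,y_N\in Y$, with independent uniform signs $\varepsilon_j=\pm1$; $Y$ has cotype $2$ if such a $C$ exists. Let $m,n\ge 1$ be integers, let $r\ge 1$ be real, let $\mathbf p=(p_1,\dots,p_m)\in[1,+\infty]^m$, and write $\left|\frac1{\mathbf p}\right|=\frac1{p_1}+\dots+\frac1{p_m}$ (with $\frac1\infty=0$). Let $A:\ell_{p_1}^n\times\dots\times\ell_{p_m}^n\to X$ be $m$-linear, where $\ell_p^n$ is $\mathbb K^n$ with the $\ell_p$ norm, and let $\|A\|$ be the supremum of $\|A(z^{(1)},\dots,z^{(m)})\|$ over $\|z^{(k)}\|_{\ell_{p_k}^n}\le1$. Let $v:X\to Y$ be an $(r,1)$-summing operator, that is, a bounded linear operator for which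 there is $C\ge0$ with $$\Big(\sum_{j=1}^N\|v(x_j)\|^r\Big)^{1/r}\le C\sup_{\varphi\in X^*,\ \|\varphi\|\le1}\ \sum_{j=1}^N|\varphi(x_j)|$$ for all $N$ and all $x_1,\dots,x_N\in X$, and let $\pi_{r,1}(v)$ be the least such $C$. Assume that $$\left|\frac1{\mathbf p}\right|<\frac1r\qquad\text{and}\qquad \sum_{k\ne l}\frac1{p_k}\le\frac1r-\frac12\quad\text{for every } l\in\{1,\dots,m\},$$ and put $\lambda=\dfrac{1}{\frac1r-\left|\frac1{\mathbf p}\right|}$. Then, for every $k\in\{1,\dots,m\}$, $$\Big(\sum_{i_k=1}^n\Big(\sum_{\widehat{i_k}}\|vA(e_{i_1},\dots,e_{i_m})\|^2\Big)^{\lambda/2}\Big)^{1/\lambda}\le\big(\sqrt2\,C_2(Y)\big)^{m-1}\,\pi_{r,1}(v)\,\|A\|,$$ where $e_1,\dots,e_n$ is the canonical basis of $\mathbb K^n$ and $\sum_{\widehat{i_k}}$ is the sum over all indices $i_l\in\{1,\dots,n\}$ with $l\ne k$. -/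

import Mathlib

open scoped ENNReal BigOperators

noncomputable section

/-- The second Rademacher moment `E ‖∑ j, ε j • y j‖ ^ 2` of finitely many vectors, where the
signs `ε j` are independent and uniform on `{1, -1}`. -/
def rademacherSecondMoment {Y : Type*} [NormedAddCommGroup Y] {N : ℕ} (y : Fin N → Y) : ℝ :=
  (∑ ε : Fin N → ℤˣ, ‖∑ j, ε j • y j‖ ^ 2) / 2 ^ N

/-- `C ≥ 0` is admissible in the cotype 2 inequality of `Y`: for all finite families,
`(∑ j, ‖y j‖ ^ 2) ^ (1/2) ≤ C * (E ‖∑ j, ε j • y j‖ ^ 2) ^ (1/2)`. -/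
def IsCotypeTwoConst (Y : Type*) [NormedAddCommGroup Y] (C : ℝ) : Prop :=
  0 ≤ C ∧ ∀ (N : ℕ) (y : Fin N → Y),
    Real.sqrt (∑ j, ‖y j‖ ^ 2) ≤ C * Real.sqrt (rademacherSecondMoment y)

/-- `Y` has cotype 2. -/
def HasCotypeTwo (Y : Type*) [NormedAddCommGroup Y] : Prop :=
  ∃ C : ℝ, IsCotypeTwoConst Y C

/-- The cotype 2 constant `C₂(Y)`: the infimum of the admissible constants. -/
def cotypeTwoConst (Y : Type*) [NormedAddCommGroup Y] : ℝ :=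
  sInf {C : ℝ | IsCotypeTwoConst Y C}

/-- The weak `ℓ₁` norm of a finite family: the supremum of `∑ j, |φ (x j)|` over all `φ` in the
closed unit ball of the dual. -/
def weakL1Norm (𝕜 : Type*) [RCLike 𝕜] {X : Type*} [NormedAddCommGroup X] [NormedSpace 𝕜 X]
    {N : ℕ} (x : Fin N → X) : ℝ :=
  sSup {t : ℝ | ∃ φ : X →L[𝕜] 𝕜, ‖φ‖ ≤ 1 ∧ t = ∑ j, ‖φ (x j)‖}

/-- `C ≥ 0` is admissible in the definition of an `(r, 1)`-summing operator: for all finite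
families, `(∑ j, ‖v (x j)‖ ^ r) ^ (1/r) ≤ C * weakL1Norm x`. -/
def IsSummingConst {𝕜 : Type*} [RCLike 𝕜] {X Y : Type*}
    [NormedAddCommGroup X] [NormedSpace 𝕜 X] [NormedAddCommGroup Y] [NormedSpace 𝕜 Y]
    (r : ℝ) (v : X →L[𝕜] Y) (C : ℝ) : Prop :=
  0 ≤ C ∧ ∀ (N : ℕ) (x : Fin N → X),
    (∑ j, ‖v (x j)‖ ^ r) ^ (1 / r) ≤ C * weakL1Norm 𝕜 x

/-- `v` is `(r, 1)`-summing. -/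
def IsSumming {𝕜 : Type*} [RCLike 𝕜] {X Y : Type*}
    [NormedAddCommGroup X] [NormedSpace 𝕜 X] [NormedAddCommGroup Y] [NormedSpace 𝕜 Y]
    (r : ℝ) (v : X →L[𝕜] Y) : Prop :=
  ∃ C : ℝ, IsSummingConst r v C

/-- The `(r, 1)`-summing norm `π_{r,1}(v)`: the infimum of the admissible constants. -/
def summingNorm {𝕜 : Type*} [RCLike 𝕜] {X Y : Type*}
    [NormedAddCommGroup X] [NormedSpace 𝕜 X] [NormedAddCommGroup Y] [NormedSpace 𝕜 Y]
    (r : ℝ) (v : X →L[𝕜] Y) : ℝ :=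
  sInf {C : ℝ | IsSummingConst r v C}

/-- The `i`-th canonical basis vector of `ℓ_q^n` over `𝕜`. -/
def stdBasisVec (𝕜 : Type*) [RCLike 𝕜] (q : ℝ≥0∞) {n : ℕ} (i : Fin n) :
    PiLp q (fun _ : Fin n => 𝕜) :=
  WithLp.toLp q (Pi.single i 1)

end

/-! The argument proves a weighted inequality with exponents (r, 2) and then trades the weights for
the exponent λ. Weighted inequality: multiply each coordinate l by a fixed w_l in the unit ball of
ℓ_{p_l} and randomise the signs in every coordinate except k. Unimodular factors do not change the
norms, so for each choice of signs the vectors obtained along coordinate k have weak ℓ₁ norm at most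
‖A‖, and the summing property of v bounds the ℓ_r norm of their images. Jensen's inequality passes
this to the average over signs, and cotype 2 in the other m - 1 coordinates turns that average into
an ℓ₂ sum (`sum_weighted_coeff_rpow_le`). Since only r ≥ 1 is available, cotype is needed against
the first Rademacher moment. The factor √2 per coordinate is the sharp L₁–L₂ Kahane–Khinchine
constant, obtained from a spectral gap for even functions on the cube (`rademacherSecondMoment_le`).
Removing the weights: the bound holds for all w_l in the ball, so duality in Hölder's inequality
removes w_l and lowers the reciprocal exponent by 1/p_l. This is direct when l is the outer index.
When l is an inner index, two such bounds are interpolated, which requires the new exponent to be at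
most 2 (`sum_rpow_sum_le_of_multipliers`). The hypothesis on the sums over k ≠ l keeps the exponent
at most 2 until only the outer coordinate is left; its weight is removed last, with no such
restriction. -/

/-! ### Spectral gap on the discrete cube and the Kahane–Khinchine inequality -/

/-- The sign vector `ε` with its `i`-th sign reversed. -/
def flipSign {N : ℕ} (i : Fin N) (ε : Fin N → ℤˣ) : Fin N → ℤˣ :=
  Function.update ε i (-ε i)

theorem flipSign_flipSign {N : ℕ} (i : Fin N) (ε : Fin N → ℤˣ) :
    flipSign i (flipSign i ε) = ε := by
  simp [flipSign]

theorem sum_comp_flipSign {N : ℕ} (i : Fin N) (f : (Fin N → ℤˣ) → ℝ) :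
    ∑ ε, f (flipSign i ε) = ∑ ε, f ε :=
  Equiv.sum_comp (Function.Involutive.toPerm (flipSign i) (flipSign_flipSign i)) f

theorem sum_signs {M : Type*} [AddCommMonoid M] (f : ℤˣ → M) : ∑ t, f t = f 1 + f (-1) := by
  have : (Finset.univ : Finset ℤˣ) = {1, -1} := rfl
  rw [this, Finset.sum_pair (by decide)]

theorem sum_signs_cons {N : ℕ} {M : Type*} [AddCommMonoid M] (f : (Fin (N + 1) → ℤˣ) → M) :
    ∑ ε, f ε = ∑ ε : Fin N → ℤˣ, (f (Fin.cons 1 ε) + f (Fin.cons (-1) ε)) := by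
  rw [← Equiv.sum_comp (Fin.consEquiv (fun _ : Fin (N + 1) => ℤˣ)), Fintype.sum_prod_type,
    sum_signs, ← Finset.sum_add_distrib]
  rfl

/-- The (unnormalised) Dirichlet form of the discrete cube. -/
noncomputable def cubeEnergy {N : ℕ} (f : (Fin N → ℤˣ) → ℝ) : ℝ :=
  (∑ i, ∑ ε, (f ε - f (flipSign i ε)) ^ 2) / 4

theorem cubeEnergy_nonneg {N : ℕ} (f : (Fin N → ℤˣ) → ℝ) : 0 ≤ cubeEnergy f := by
  unfold cubeEnergy; positivity

/-- The even part of `f` in its first variable. -/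
noncomputable def consMean {N : ℕ} (f : (Fin (N + 1) → ℤˣ) → ℝ) (ε : Fin N → ℤˣ) : ℝ :=
  (f (Fin.cons 1 ε) + f (Fin.cons (-1) ε)) / 2

/-- The odd part of `f` in its first variable. -/
noncomputable def consDiff {N : ℕ} (f : (Fin (N + 1) → ℤˣ) → ℝ) (ε : Fin N → ℤˣ) : ℝ :=
  (f (Fin.cons 1 ε) - f (Fin.cons (-1) ε)) / 2

theorem sum_cons_eq {N : ℕ} (f : (Fin (N + 1) → ℤˣ) → ℝ) : ∑ ε, f ε = 2 * ∑ ε, consMean f ε := by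
  rw [sum_signs_cons, Finset.mul_sum]
  exact Finset.sum_congr rfl fun ε _ => by unfold consMean; ring

theorem sum_cons_sq {N : ℕ} (f : (Fin (N + 1) → ℤˣ) → ℝ) :
    ∑ ε, f ε ^ 2 = 2 * (∑ ε, consMean f ε ^ 2 + ∑ ε, consDiff f ε ^ 2) := by
  rw [sum_signs_cons, ← Finset.sum_add_distrib, Finset.mul_sum]
  exact Finset.sum_congr rfl fun ε _ => by unfold consMean consDiff; ring

theorem flipSign_zero_cons {N : ℕ} (t : ℤˣ) (ε : Fin N → ℤˣ) :
    flipSign 0 (Fin.cons t ε : Fin (N + 1) → ℤˣ) = Fin.cons (-t) ε := by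
  simp [flipSign]

theorem flipSign_succ_cons {N : ℕ} (i : Fin N) (t : ℤˣ) (ε : Fin N → ℤˣ) :
    flipSign i.succ (Fin.cons t ε : Fin (N + 1) → ℤˣ) = Fin.cons t (flipSign i ε) := by
  simp [flipSign, Fin.cons_update]

theorem cubeEnergy_cons {N : ℕ} (f : (Fin (N + 1) → ℤˣ) → ℝ) :
    cubeEnergy f = 2 * (cubeEnergy (consMean f) + cubeEnergy (consDiff f) +
      ∑ ε, consDiff f ε ^ 2) := by
  have h0 : ∑ ε, (f ε - f (flipSign 0 ε)) ^ 2 = 8 * ∑ ε, consDiff f ε ^ 2 := by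
    rw [sum_signs_cons, Finset.mul_sum]
    refine Finset.sum_congr rfl fun ε _ => ?_
    rw [flipSign_zero_cons, flipSign_zero_cons, neg_neg]
    unfold consDiff; ring
  have h1 : ∀ i : Fin N, ∑ ε, (f ε - f (flipSign i.succ ε)) ^ 2 =
      2 * (∑ ε, (consMean f ε - consMean f (flipSign i ε)) ^ 2 +
        ∑ ε, (consDiff f ε - consDiff f (flipSign i ε)) ^ 2) := by
    intro i
    rw [sum_signs_cons, ← Finset.sum_add_distrib, Finset.mul_sum]
    refine Finset.sum_congr rfl fun ε _ => ?_
    rw [flipSign_succ_cons, flipSign_succ_cons]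
    unfold consDiff consMean; ring
  unfold cubeEnergy
  rw [Fin.sum_univ_succ, h0, Finset.sum_congr rfl fun i _ => h1 i, ← Finset.mul_sum,
    Finset.sum_add_distrib]
  ring

theorem neg_cons_sign {N : ℕ} (t : ℤˣ) (ε : Fin N → ℤˣ) :
    (Fin.cons t (-ε) : Fin (N + 1) → ℤˣ) = -(Fin.cons (-t) ε : Fin (N + 1) → ℤˣ) := by
  ext i
  refine Fin.cases ?_ (fun i => ?_) i <;> simp

/-- In Walsh expansion `cubeEnergy` weights the squared coefficient of a set S by |S|, and an odd
function has only coefficients with |S| odd, hence at least 1. -/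
theorem sum_sq_le_cubeEnergy_of_odd {N : ℕ} (f : (Fin N → ℤˣ) → ℝ) (hf : ∀ ε, f (-ε) = -f ε) :
    ∑ ε, f ε ^ 2 ≤ cubeEnergy f := by
  induction N with
  | zero =>
    have h : ∀ ε, f ε = 0 := fun ε => by
      have := hf ε
      rw [Subsingleton.elim (-ε) ε] at this
      linarith
    simp [h, cubeEnergy]
  | succ N ih =>
    have h := ih (consMean f) fun ε => by
      unfold consMean
      rw [neg_cons_sign, neg_cons_sign, hf, hf, neg_neg]; ring
    have := cubeEnergy_nonneg (consDiff f)
    rw [sum_cons_sq, cubeEnergy_cons]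
    linarith

/-- An even function has only coefficients with |S| even, so the non-constant ones have |S| ≥ 2 and
the gap doubles. In the induction the mean part is again even and the difference part is odd. -/
theorem variance_le_cubeEnergy_of_even {N : ℕ} (f : (Fin N → ℤˣ) → ℝ) (hf : ∀ ε, f (-ε) = f ε) :
    2 * (∑ ε, f ε ^ 2 - (∑ ε, f ε) ^ 2 / 2 ^ N) ≤ cubeEnergy f := by
  induction N with
  | zero => simp [cubeEnergy]
  | succ N ih =>
    have h := ih (consMean f) fun ε => by
      unfold consMean
      rw [neg_cons_sign, neg_cons_sign, hf, hf, neg_neg, add_comm]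
    have h' := sum_sq_le_cubeEnergy_of_odd (consDiff f) fun ε => by
      unfold consDiff
      rw [neg_cons_sign, neg_cons_sign, hf, hf, neg_neg]; ring
    have e : (2 * ∑ ε, consMean f ε) ^ 2 / 2 ^ (N + 1) =
        2 * ((∑ ε, consMean f ε) ^ 2 / 2 ^ N) := by
      rw [pow_succ (2 : ℝ) N]; field_simp
    rw [sum_cons_sq, cubeEnergy_cons, sum_cons_eq, e]
    linarith

theorem sum_signs_flip_smul {Y : Type*} [NormedAddCommGroup Y] {N : ℕ} (y : Fin N → Y)
    (ε : Fin N → ℤˣ) (i : Fin N) :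
    ∑ j, flipSign i ε j • y j = ∑ j, ε j • y j - (2 : ℤ) • (ε i • y i) := by
  have h : ∑ j, (ε j • y j - flipSign i ε j • y j) = (2 : ℤ) • (ε i • y i) := by
    rw [Finset.sum_eq_single i]
    · simp [flipSign, two_smul, Units.smul_def]
    · intro j _ hj
      simp [flipSign, hj]
    · simp
  rw [← h, Finset.sum_sub_distrib, sub_sub_cancel]

/-- The Kahane–Khinchine inequality between the first and second moments, with the best
constant `√2` (Latała–Oleszkiewicz). -/
theorem rademacherSecondMoment_le {Y : Type*} [NormedAddCommGroup Y] [NormedSpace ℝ Y] {N : ℕ}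
    (y : Fin N → Y) :
    rademacherSecondMoment y ≤ 2 * ((∑ ε : Fin N → ℤˣ, ‖∑ j, ε j • y j‖) / 2 ^ N) ^ 2 := by
  set f : (Fin N → ℤˣ) → ℝ := fun ε => ‖∑ j, ε j • y j‖ with hf
  have heven : ∀ ε, f (-ε) = f ε := fun ε => by
    simp [hf, Units.smul_def, Finset.sum_neg_distrib]
  have hvar := variance_le_cubeEnergy_of_even f heven
  have hflip : ∀ ε, ((N : ℝ) - 2) * f ε ≤ ∑ i, f (flipSign i ε) := by
    intro ε
    -- Over the N flips, each term keeps its sign N - 1 times and changes it once.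
    have h1 : ∑ i, ∑ j, flipSign i ε j • y j = ((N : ℝ) - 2) • ∑ j, ε j • y j := by
      simp_rw [sum_signs_flip_smul]
      rw [Finset.sum_sub_distrib, ← Finset.smul_sum, sub_smul]
      simp [← Nat.cast_smul_eq_nsmul ℝ, two_smul]
    calc ((N : ℝ) - 2) * f ε ≤ |(N : ℝ) - 2| * f ε :=
          mul_le_mul_of_nonneg_right (le_abs_self _) (norm_nonneg _)
      _ = ‖∑ i, ∑ j, flipSign i ε j • y j‖ := by rw [h1, norm_smul, Real.norm_eq_abs]
      _ ≤ _ := norm_sum_le _ _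
  -- The energy is ⟨f, Lf⟩ with Lf = ½ ∑ i, (f - f ∘ `flipSign i`), and `hflip` says Lf ≤ f
  -- pointwise.
  have henergy : cubeEnergy f ≤ ∑ ε, f ε ^ 2 := by
    have e1 : ∀ i, ∑ ε, (f ε - f (flipSign i ε)) ^ 2 =
        2 * ∑ ε, f ε ^ 2 - 2 * ∑ ε, f ε * f (flipSign i ε) := by
      intro i
      have := sum_comp_flipSign i fun ε => f ε ^ 2
      calc _ = ∑ ε, (f ε ^ 2 + f (flipSign i ε) ^ 2 - 2 * (f ε * f (flipSign i ε))) :=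
            Finset.sum_congr rfl fun ε _ => by ring
        _ = _ := by
          rw [Finset.sum_sub_distrib, Finset.sum_add_distrib, this, ← Finset.mul_sum]; ring
    have e2 : ((N : ℝ) - 2) * ∑ ε, f ε ^ 2 ≤ ∑ i, ∑ ε, f ε * f (flipSign i ε) := by
      rw [Finset.sum_comm, Finset.mul_sum]
      refine Finset.sum_le_sum fun ε _ => ?_
      rw [← Finset.mul_sum]
      nlinarith [hflip ε, norm_nonneg (∑ j, ε j • y j)]
    unfold cubeEnergy
    rw [Finset.sum_congr rfl fun i _ => e1 i, Finset.sum_sub_distrib, ← Finset.mul_sum (f := fun i => ∑ ε, f ε * f (flipSign i ε))]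
    simp only [Finset.sum_const, Finset.card_univ, Fintype.card_fin, nsmul_eq_mul]
    linarith
  have h2 : ∑ ε, f ε ^ 2 ≤ 2 * ((∑ ε, f ε) ^ 2 / 2 ^ N) := by linarith
  have hN : (0 : ℝ) < 2 ^ N := by positivity
  change (∑ ε, f ε ^ 2) / 2 ^ N ≤ 2 * ((∑ ε, f ε) / 2 ^ N) ^ 2
  rw [div_le_iff₀ hN]
  calc _ ≤ _ := h2
    _ = _ := by field_simp

/-! ### Hölder's inequality and its converse -/

/-- Zero exponents are allowed because the interpolation parameter below vanishes when t = 2. -/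
theorem sum_rpow_mul_rpow_le {ι : Type*} (s : Finset ι) {f g : ι → ℝ} {a b : ℝ}
    (hf : ∀ i ∈ s, 0 ≤ f i) (hg : ∀ i ∈ s, 0 ≤ g i) (ha : 0 ≤ a) (hb : 0 ≤ b) (hab : a + b = 1) :
    ∑ i ∈ s, f i ^ a * g i ^ b ≤ (∑ i ∈ s, f i) ^ a * (∑ i ∈ s, g i) ^ b := by
  rcases ha.eq_or_lt with rfl | ha
  · simp [show b = 1 by linarith]
  rcases hb.eq_or_lt with rfl | hb
  · simp [show a = 1 by linarith]
  have hc : (1 / a).HolderConjugate (1 / b) := by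
    rw [Real.holderConjugate_iff]
    refine ⟨by rw [lt_div_iff₀ ha]; linarith, by simpa using hab⟩
  have := Real.inner_le_Lp_mul_Lq_of_nonneg s hc (f := fun i => f i ^ a) (g := fun i => g i ^ b)
    (fun i hi => Real.rpow_nonneg (hf i hi) _) (fun i hi => Real.rpow_nonneg (hg i hi) _)
  refine this.trans_eq ?_
  rw [one_div_one_div, one_div_one_div]
  congr 2
  · refine Finset.sum_congr rfl fun i hi => ?_
    rw [← Real.rpow_mul (hf i hi), mul_one_div_cancel ha.ne', Real.rpow_one]
  · refine Finset.sum_congr rfl fun i hi => ?_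
    rw [← Real.rpow_mul (hg i hi), mul_one_div_cancel hb.ne', Real.rpow_one]

/-- Converse Hölder inequality, in the form in which multipliers from `ℓ_q` are removed. -/
theorem sum_rpow_le_of_multipliers {κ : Type*} [Fintype κ] {V : κ → ℝ} (hV : ∀ c, 0 ≤ V c)
    {s t q C : ℝ} (hs : 0 < s) (hq : 0 < q) (ht : 0 < t) (hst : 1 / t = 1 / s - 1 / q)
    (hC : 0 ≤ C)
    (h : ∀ u : κ → ℝ, (∀ c, 0 ≤ u c) → ∑ c, u c ^ q ≤ 1 → ∑ c, u c ^ s * V c ≤ C ^ s) :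
    ∑ c, V c ^ (t / s) ≤ C ^ t := by
  have hc : (t / s).HolderConjugate (q / s) := by
    rw [Real.holderConjugate_iff]
    constructor
    · rw [lt_div_iff₀ hs, one_mul]
      have : 1 / t < 1 / s := by rw [hst]; linarith [one_div_pos.2 hq]
      exact (one_div_lt_one_div ht hs).1 this
    · field_simp at hst ⊢; linarith
  -- The extremal g for the duality of ℓ_{t/s} and ℓ_{q/s}; the multiplier tested is u = g^(1/s).
  obtain ⟨⟨g, hg, hgV⟩, -⟩ := NNReal.isGreatest_Lp (s := Finset.univ)
    (fun c => (V c).toNNReal) hc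
  have key := h (fun c => (g c : ℝ) ^ (1 / s)) (fun c => by positivity) (by
    have : ∑ c, g c ^ (q / s) ≤ 1 := hg
    have := NNReal.coe_le_coe.2 this
    push_cast at this
    refine le_trans (le_of_eq ?_) this
    refine Finset.sum_congr rfl fun c _ => ?_
    rw [← Real.rpow_mul (g c).coe_nonneg]; congr 1; ring)
  have e : ∑ c, ((g c : ℝ) ^ (1 / s)) ^ s * V c = (∑ c, V c ^ (t / s)) ^ (1 / (t / s)) := by
    have := congrArg (fun x : NNReal => (x : ℝ)) hgV
    simp only [NNReal.coe_sum, NNReal.coe_mul, NNReal.coe_rpow, Real.coe_toNNReal _ (hV _)] at this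
    refine Eq.trans ?_ this
    refine Finset.sum_congr rfl fun c _ => ?_
    rw [← Real.rpow_mul (g c).coe_nonneg, one_div_mul_cancel hs.ne', Real.rpow_one, mul_comm]
  rw [e] at key
  have h0 : 0 ≤ ∑ c, V c ^ (t / s) := Finset.sum_nonneg fun c _ => Real.rpow_nonneg (hV c) _
  have := Real.rpow_le_rpow (Real.rpow_nonneg h0 _) key (div_pos ht hs).le
  rwa [← Real.rpow_mul h0, one_div_mul_cancel (div_pos ht hs).ne', Real.rpow_one,
    ← Real.rpow_mul hC, mul_div_cancel₀ _ hs.ne'] at this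

/-- Removal of the multipliers acting on the inner index of a mixed `(s, 2)` norm. -/
theorem sum_rpow_sum_le_of_multipliers {κ κ' : Type*} [Fintype κ] [Fintype κ'] {b : κ' → κ → ℝ}
    (hb : ∀ j c, 0 ≤ b j c)
    {s t q C : ℝ} (hs : 0 < s) (hq : 0 < q) (ht : 0 < t) (ht2 : t ≤ 2)
    (hst : 1 / t = 1 / s - 1 / q) (hC : 0 ≤ C)
    (hin : ∀ u : κ → ℝ, (∀ c, 0 ≤ u c) → ∑ c, u c ^ q ≤ 1 →
      ∑ j, (∑ c, u c ^ 2 * b j c) ^ (s / 2) ≤ C ^ s)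
    (hout : ∀ u : κ → ℝ, (∀ c, 0 ≤ u c) → ∑ c, u c ^ q ≤ 1 →
      ∑ c, (u c ^ 2 * ∑ j, b j c) ^ (s / 2) ≤ C ^ s) :
    ∑ j, (∑ c, b j c) ^ (t / 2) ≤ C ^ t := by
  have hlt : s < t := by
    refine (one_div_lt_one_div ht hs).1 ?_
    rw [hst]; linarith [one_div_pos.2 hq]
  have hs2 : s < 2 := hlt.trans_le ht2
  have hsq : ∀ x : ℝ, 0 ≤ x → (x ^ 2) ^ (s / 2) = x ^ s := fun x hx => by
    rw [← Real.rpow_natCast, ← Real.rpow_mul hx]; congr 1; push_cast; ring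
  set T : κ' → ℝ := fun j => ∑ c, b j c with hT
  have hT0 : ∀ j, 0 ≤ T j := fun j => Finset.sum_nonneg fun c _ => hb j c
  set V : κ → ℝ := fun c => ∑ j, b j c with hVdef
  have hV0 : ∀ c, 0 ≤ V c := fun c => Finset.sum_nonneg fun j _ => hb j c
  -- The weight T_j^(s/2 - 1) linearises the power s/2 of the inner sum, so that `hin` becomes a
  -- bound to which the converse Hölder inequality applies.
  set U : κ → ℝ := fun c => ∑ j, b j c * T j ^ (s / 2 - 1) with hUdef
  have hbT : ∀ j c, 0 ≤ b j c * T j ^ (s / 2 - 1) := fun j c =>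
    mul_nonneg (hb j c) (Real.rpow_nonneg (hT0 j) _)
  have hU0 : ∀ c, 0 ≤ U c := fun c => Finset.sum_nonneg fun j _ => hbT j c
  have hV : ∑ c, V c ^ (t / 2) ≤ C ^ t := by
    have := sum_rpow_le_of_multipliers (V := fun c => V c ^ (s / 2))
      (fun c => Real.rpow_nonneg (hV0 c) _) hs hq ht hst hC (by
        intro u hu huq
        refine le_trans (le_of_eq (Finset.sum_congr rfl fun c _ => ?_)) (hout u hu huq)
        rw [Real.mul_rpow (sq_nonneg _) (hV0 c), hsq _ (hu c)])
    refine le_trans (le_of_eq (Finset.sum_congr rfl fun c _ => ?_)) this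
    rw [← Real.rpow_mul (hV0 c)]; congr 1; field_simp
  have hU : ∑ c, U c ^ (t / s) ≤ C ^ t := by
    refine sum_rpow_le_of_multipliers hU0 hs hq ht hst hC fun u hu huq => ?_
    refine le_trans ?_ (hin u hu huq)
    simp_rw [hUdef, Finset.mul_sum]
    rw [Finset.sum_comm]
    refine Finset.sum_le_sum fun j _ => ?_
    have h1 : ∑ c, u c ^ s * b j c ≤ (∑ c, u c ^ 2 * b j c) ^ (s / 2) * T j ^ (1 - s / 2) := by
      refine le_trans (le_of_eq (Finset.sum_congr rfl fun c _ => ?_))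
        (sum_rpow_mul_rpow_le Finset.univ (f := fun c => u c ^ 2 * b j c) (g := b j)
          (a := s / 2) (b := 1 - s / 2)
          (fun c _ => mul_nonneg (sq_nonneg _) (hb j c)) (fun c _ => hb j c)
          (by linarith) (by linarith) (by ring))
      rw [Real.mul_rpow (sq_nonneg _) (hb j c), hsq _ (hu c), mul_assoc,
        ← Real.rpow_add' (hb j c) (by norm_num)]
      simp
    -- The product is 1 if T_j > 0, but 0 if T_j = 0.
    have h2 : T j ^ (1 - s / 2) * T j ^ (s / 2 - 1) ≤ 1 := by
      rcases (hT0 j).eq_or_lt with h | h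
      · rw [← h, Real.zero_rpow (by linarith : 1 - s / 2 ≠ 0)]; simp
      · rw [← Real.rpow_add h]; simp
    have h3 : 0 ≤ (∑ c, u c ^ 2 * b j c) ^ (s / 2) :=
      Real.rpow_nonneg (Finset.sum_nonneg fun c _ => mul_nonneg (sq_nonneg _) (hb j c)) _
    calc ∑ c, u c ^ s * (b j c * T j ^ (s / 2 - 1))
        = (∑ c, u c ^ s * b j c) * T j ^ (s / 2 - 1) := by
          rw [Finset.sum_mul]; exact Finset.sum_congr rfl fun c _ => by ring
      _ ≤ ((∑ c, u c ^ 2 * b j c) ^ (s / 2) * T j ^ (1 - s / 2)) * T j ^ (s / 2 - 1) :=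
          mul_le_mul_of_nonneg_right h1 (Real.rpow_nonneg (hT0 j) _)
      _ ≤ (∑ c, u c ^ 2 * b j c) ^ (s / 2) := by
          rw [mul_assoc]; exact mul_le_of_le_one_right h3 h2
  -- Chosen so that (s/2 - 1)θ = t/2 - 1, which makes T_j^(t/2) a sum of geometric means of the
  -- terms of U and V. Here t ≤ 2 gives θ ≥ 0.
  set θ : ℝ := (2 - t) / (2 - s) with hθ
  have hθ0 : 0 ≤ θ := div_nonneg (by linarith) (by linarith)
  have hθ1 : θ ≤ 1 := by rw [hθ, div_le_one (by linarith)]; linarith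
  have hsplit : ∀ j, T j ^ (t / 2) =
      ∑ c, (b j c * T j ^ (s / 2 - 1)) ^ θ * b j c ^ (1 - θ) := by
    intro j
    have e : (s / 2 - 1) * θ = t / 2 - 1 := by
      rw [hθ]; field_simp [show (2 - s) ≠ 0 by linarith]; ring
    have : ∀ c, (b j c * T j ^ (s / 2 - 1)) ^ θ * b j c ^ (1 - θ) = T j ^ (t / 2 - 1) * b j c := by
      intro c
      rw [Real.mul_rpow (hb j c) (Real.rpow_nonneg (hT0 j) _), ← Real.rpow_mul (hT0 j), e,
        mul_right_comm, ← Real.rpow_add' (hb j c) (by norm_num), mul_comm]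
      simp
    rw [Finset.sum_congr rfl fun c _ => this c, ← Finset.mul_sum]
    change _ = _ * T j
    rw [← Real.rpow_add_one' (hT0 j) (by linarith)]
    congr 1; ring
  have hα : θ * (s / t) + (1 - θ) * (2 / t) = 1 := by
    rw [hθ]; field_simp [show (2 - s) ≠ 0 by linarith]; ring
  have hα0 : 0 ≤ θ * (s / t) := by positivity
  have hβ0 : 0 ≤ (1 - θ) * (2 / t) := mul_nonneg (by linarith) (by positivity)
  have hCt : 0 ≤ C ^ t := Real.rpow_nonneg hC _
  calc ∑ j, T j ^ (t / 2)
      = ∑ c, ∑ j, (b j c * T j ^ (s / 2 - 1)) ^ θ * b j c ^ (1 - θ) := by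
        rw [Finset.sum_congr rfl fun j _ => hsplit j, Finset.sum_comm]
    _ ≤ ∑ c, U c ^ θ * V c ^ (1 - θ) := Finset.sum_le_sum fun c _ =>
        sum_rpow_mul_rpow_le _ (fun j _ => hbT j c) (fun j _ => hb j c) hθ0 (by linarith) (by ring)
    _ = ∑ c, (U c ^ (t / s)) ^ (θ * (s / t)) * (V c ^ (t / 2)) ^ ((1 - θ) * (2 / t)) := by
        refine Finset.sum_congr rfl fun c _ => ?_
        rw [← Real.rpow_mul (hU0 c), ← Real.rpow_mul (hV0 c)]
        congr 2 <;> field_simp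
    _ ≤ (∑ c, U c ^ (t / s)) ^ (θ * (s / t)) * (∑ c, V c ^ (t / 2)) ^ ((1 - θ) * (2 / t)) :=
        sum_rpow_mul_rpow_le _ (fun c _ => Real.rpow_nonneg (hU0 c) _)
          (fun c _ => Real.rpow_nonneg (hV0 c) _) hα0 hβ0 hα
    _ ≤ (C ^ t) ^ (θ * (s / t)) * (C ^ t) ^ ((1 - θ) * (2 / t)) := by
        have hU' := Finset.sum_nonneg fun c (_ : c ∈ Finset.univ) => Real.rpow_nonneg (hU0 c) (t / s)
        have hV' := Finset.sum_nonneg fun c (_ : c ∈ Finset.univ) => Real.rpow_nonneg (hV0 c) (t / 2)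
        gcongr
    _ = C ^ t := by rw [← Real.rpow_add' hCt (by rw [hα]; norm_num), hα, Real.rpow_one]

/-! ### Optimal constants and cotype 2 in several indices -/

theorem isCotypeTwoConst_cotypeTwoConst {Y : Type*} [NormedAddCommGroup Y] (hY : HasCotypeTwo Y) :
    IsCotypeTwoConst Y (cotypeTwoConst Y) := by
  obtain ⟨C₀, hC₀⟩ := hY
  refine ⟨Real.sInf_nonneg fun C hC => hC.1, fun N y => ?_⟩
  rcases (Real.sqrt_nonneg (rademacherSecondMoment y)).eq_or_lt with h | h
  · simpa [← h] using hC₀.2 N y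
  · rw [← div_le_iff₀ h]
    exact le_csInf ⟨C₀, hC₀⟩ fun C hC => (div_le_iff₀ h).2 (hC.2 N y)

theorem weakL1Norm_nonneg (𝕜 : Type*) [RCLike 𝕜] {X : Type*} [NormedAddCommGroup X]
    [NormedSpace 𝕜 X] {N : ℕ} (x : Fin N → X) : 0 ≤ weakL1Norm 𝕜 x := by
  refine Real.sSup_nonneg ?_
  rintro t ⟨φ, -, rfl⟩
  positivity

theorem isSummingConst_summingNorm {𝕜 : Type*} [RCLike 𝕜] {X Y : Type*}
    [NormedAddCommGroup X] [NormedSpace 𝕜 X] [NormedAddCommGroup Y] [NormedSpace 𝕜 Y]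
    {r : ℝ} {v : X →L[𝕜] Y} (hv : IsSumming r v) : IsSummingConst r v (summingNorm r v) := by
  obtain ⟨C₀, hC₀⟩ := hv
  refine ⟨Real.sInf_nonneg fun C hC => hC.1, fun N x => ?_⟩
  rcases (weakL1Norm_nonneg 𝕜 x).eq_or_lt with h | h
  · simpa [← h] using hC₀.2 N x
  · rw [← div_le_iff₀ h]
    exact le_csInf ⟨C₀, hC₀⟩ fun C hC => (div_le_iff₀ h).2 (hC.2 N x)

/-- The first moment on the right is what makes Jensen's inequality usable later for every r ≥ 1. -/
theorem IsCotypeTwoConst.sqrt_sum_le {Y : Type*} [NormedAddCommGroup Y] [NormedSpace ℝ Y] {C : ℝ}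
    (hC : IsCotypeTwoConst Y C) {N : ℕ} (y : Fin N → Y) :
    √(∑ j, ‖y j‖ ^ 2) ≤ √2 * C * ((∑ ε : Fin N → ℤˣ, ‖∑ j, ε j • y j‖) / 2 ^ N) := by
  refine (hC.2 N y).trans ?_
  rw [mul_comm (√2), mul_assoc]
  refine mul_le_mul_of_nonneg_left ?_ hC.1
  refine (Real.sqrt_le_sqrt (rademacherSecondMoment_le y)).trans_eq ?_
  rw [Real.sqrt_mul (by norm_num), Real.sqrt_sq (by positivity)]

theorem sqrt_sum_sq_sum_le {ι α : Type*} [Fintype ι] [Fintype α] (g : α → ι → ℝ) :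
    √(∑ i, (∑ a, g a i) ^ 2) ≤ ∑ a, √(∑ i, g a i ^ 2) := by
  have := norm_sum_le Finset.univ fun a => (WithLp.toLp 2 (g a) : EuclideanSpace ℝ ι)
  simpa [EuclideanSpace.norm_eq] using this

theorem sum_pi_cons {α M : Type*} [Fintype α] [AddCommMonoid M] {m : ℕ}
    (g : (Fin (m + 1) → α) → M) :
    ∑ i, g i = ∑ a, ∑ i : Fin m → α, g (Fin.cons a i) := by
  rw [← Equiv.sum_comp (Fin.consEquiv (fun _ : Fin (m + 1) => α)), Fintype.sum_prod_type]
  rfl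

/-- The cotype 2 inequality for families with several indices and products of independent
signs. -/
theorem IsCotypeTwoConst.sqrt_sum_pi_le {Y : Type*} [NormedAddCommGroup Y] [NormedSpace ℝ Y]
    {C : ℝ} (hC : IsCotypeTwoConst Y C) {m n : ℕ} (f : (Fin m → Fin n) → Y) :
    √(∑ i, ‖f i‖ ^ 2) ≤ (√2 * C) ^ m *
      ((∑ ε : Fin m → Fin n → ℤˣ, ‖∑ i, (∏ l, ε l (i l)) • f i‖) / (2 ^ n) ^ m) := by
  induction m with
  | zero => simp [Real.sqrt_sq]
  | succ m ih =>
    have hK : 0 ≤ √2 * C := mul_nonneg (Real.sqrt_nonneg _) hC.1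
    have h2 : (0 : ℝ) < 2 ^ n := by positivity
    calc √(∑ i, ‖f i‖ ^ 2)
        = √(∑ i : Fin m → Fin n, √(∑ a, ‖f (Fin.cons a i)‖ ^ 2) ^ 2) := by
          rw [sum_pi_cons, Finset.sum_comm]
          congr 1
          exact Finset.sum_congr rfl fun i _ => (Real.sq_sqrt (by positivity)).symm
      _ ≤ √(∑ i : Fin m → Fin n, (∑ ε : Fin n → ℤˣ,
            √2 * C / 2 ^ n * ‖∑ a, ε a • f (Fin.cons a i)‖) ^ 2) := by
          gcongr with i
          refine (hC.sqrt_sum_le fun a => f (Fin.cons a i)).trans_eq ?_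
          rw [← Finset.mul_sum]; ring
      -- Minkowski's inequality takes the average over the first signs out of the ℓ₂ norm, leaving m
      -- indices for the induction hypothesis.
      _ ≤ ∑ ε : Fin n → ℤˣ, √(∑ i : Fin m → Fin n,
            (√2 * C / 2 ^ n * ‖∑ a, ε a • f (Fin.cons a i)‖) ^ 2) := sqrt_sum_sq_sum_le _
      _ = ∑ ε : Fin n → ℤˣ, √2 * C / 2 ^ n * √(∑ i : Fin m → Fin n,
            ‖∑ a, ε a • f (Fin.cons a i)‖ ^ 2) := by
          refine Finset.sum_congr rfl fun ε _ => ?_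
          simp_rw [mul_pow, ← Finset.mul_sum]
          rw [Real.sqrt_mul (by positivity), Real.sqrt_sq (by positivity)]
      _ ≤ ∑ ε : Fin n → ℤˣ, √2 * C / 2 ^ n * ((√2 * C) ^ m *
            ((∑ ε' : Fin m → Fin n → ℤˣ,
              ‖∑ i, (∏ l, ε' l (i l)) • ∑ a, ε a • f (Fin.cons a i)‖) / (2 ^ n) ^ m)) := by
          gcongr with ε
          exact ih _
      _ = _ := by
          rw [sum_pi_cons (fun ε : Fin (m + 1) → Fin n → ℤˣ => ‖∑ i, (∏ l, ε l (i l)) • f i‖),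
            Finset.sum_div, Finset.mul_sum]
          refine Finset.sum_congr rfl fun ε _ => ?_
          have : ∀ ε' : Fin m → Fin n → ℤˣ,
              ∑ i, (∏ l, (Fin.cons ε ε' : Fin (m + 1) → Fin n → ℤˣ) l (i l)) • f i =
              ∑ i, (∏ l, ε' l (i l)) • ∑ a, ε a • f (Fin.cons a i) := by
            intro ε'
            rw [sum_pi_cons, Finset.sum_comm]
            refine Finset.sum_congr rfl fun i _ => ?_
            rw [Finset.smul_sum]
            refine Finset.sum_congr rfl fun a _ => ?_
            rw [Fin.prod_univ_succ, smul_smul, mul_comm]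
            simp
          simp_rw [this]
          rw [pow_succ (√2 * C), pow_succ ((2 : ℝ) ^ n)]
          field_simp

/-! ### Coordinate expansions and weak ℓ₁ norms -/

theorem sum_filter_eq_sum_insertNth {M : Type*} [AddCommMonoid M] {m n : ℕ} (k : Fin (m + 1))
    (j : Fin n) (g : (Fin (m + 1) → Fin n) → M) :
    ∑ i with i k = j, g i = ∑ i : Fin m → Fin n, g (k.insertNth j i) := by
  rw [Finset.sum_filter, ← Equiv.sum_comp (Fin.insertNthEquiv (fun _ => Fin n) k),
    Fintype.sum_prod_type, Finset.sum_eq_single j]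
  · simp [Fin.insertNthEquiv]
  · intro b _ hb
    simp [hb]
  · simp

theorem PiLp.norm_toLp_congr {E F : Type*} [NormedAddCommGroup E] [NormedAddCommGroup F]
    {n : ℕ} (q : ℝ≥0∞) [Fact (1 ≤ q)] {f : Fin n → E} {g : Fin n → F}
    (h : ∀ i, ‖f i‖ = ‖g i‖) : ‖WithLp.toLp q f‖ = ‖WithLp.toLp q g‖ := by
  have h1 : 1 ≤ q := Fact.out
  rcases eq_or_ne q ∞ with rfl | hq
  · simp [PiLp.norm_eq_ciSup, h]
  · have : 0 < q.toReal := ENNReal.toReal_pos (by positivity) hq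
    simp [PiLp.norm_eq_sum this, h]

section Multilinear

variable {𝕜 : Type*} [RCLike 𝕜] {X : Type*} [NormedAddCommGroup X] [NormedSpace 𝕜 X]
  {m n : ℕ} {p : Fin m → ℝ≥0∞}

theorem toLp_eq_sum_stdBasisVec (q : ℝ≥0∞) (c : Fin n → 𝕜) :
    WithLp.toLp q c = ∑ i, c i • stdBasisVec 𝕜 q i := by
  ext j
  simp [stdBasisVec, Pi.single_apply]

theorem map_toLp_eq_sum [∀ k, Fact (1 ≤ p k)]
    (A : ContinuousMultilinearMap 𝕜 (fun k : Fin m => PiLp (p k) (fun _ : Fin n => 𝕜)) X)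
    (c : Fin m → Fin n → 𝕜) :
    A (fun l => WithLp.toLp (p l) (c l)) =
      ∑ i : Fin m → Fin n, (∏ l, c l (i l)) • A (fun l => stdBasisVec 𝕜 (p l) (i l)) := by
  simp_rw [toLp_eq_sum_stdBasisVec]
  rw [ContinuousMultilinearMap.map_sum]
  exact Finset.sum_congr rfl fun i _ => A.map_smul_univ _ _

/-- Unimodular scalars align the values of φ, so the sum of moduli is φ ∘ A at a single point whose
k-th coordinate has been rotated entrywise; this point stays in the product of unit balls. -/
theorem weakL1Norm_update_le [∀ k, Fact (1 ≤ p k)]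
    (A : ContinuousMultilinearMap 𝕜 (fun k : Fin m => PiLp (p k) (fun _ : Fin n => 𝕜)) X)
    (c : Fin m → Fin n → 𝕜) (hc : ∀ l, ‖WithLp.toLp (p l) (c l)‖ ≤ 1) (k : Fin m) :
    weakL1Norm 𝕜 (fun j : Fin n => A (Function.update (fun l => WithLp.toLp (p l) (c l)) k
      (c k j • stdBasisVec 𝕜 (p k) j))) ≤ ‖A‖ := by
  set z : ∀ l, PiLp (p l) (fun _ : Fin n => 𝕜) := fun l => WithLp.toLp (p l) (c l) with hz
  refine Real.sSup_le ?_ (norm_nonneg _)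
  rintro t ⟨φ, hφ, rfl⟩
  choose u hu hux using fun j => RCLike.exists_norm_eq_mul_self
    (φ (A (Function.update z k (c k j • stdBasisVec 𝕜 (p k) j))))
  have key : ((∑ j, ‖φ (A (Function.update z k (c k j • stdBasisVec 𝕜 (p k) j)))‖ : ℝ) : 𝕜) =
      φ (A (Function.update z k (WithLp.toLp (p k) fun j => u j * c k j))) := by
    have hadd : A (Function.update z k (∑ j, (u j * c k j) • stdBasisVec 𝕜 (p k) j)) =
        ∑ j, A (Function.update z k ((u j * c k j) • stdBasisVec 𝕜 (p k) j)) :=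
      A.toMultilinearMap.map_update_sum Finset.univ k _ z
    rw [toLp_eq_sum_stdBasisVec, hadd, map_sum]
    push_cast
    refine Finset.sum_congr rfl fun j _ => ?_
    refine (hux j).trans ?_
    simp only [mul_smul, A.map_update_smul, map_smul, smul_eq_mul]
  have hnorm : ∀ l, ‖Function.update z k (WithLp.toLp (p k) fun j => u j * c k j) l‖ ≤ 1 := by
    intro l
    by_cases h : l = k
    · subst h
      rw [Function.update_self]
      refine le_of_eq_of_le (PiLp.norm_toLp_congr (p l) fun i => ?_) (hc l)
      rw [norm_mul, hu, one_mul]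
    · rw [Function.update_of_ne h]; exact hc l
  calc ∑ j, ‖φ (A (Function.update z k (c k j • stdBasisVec 𝕜 (p k) j)))‖
      = ‖φ (A (Function.update z k (WithLp.toLp (p k) fun j => u j * c k j)))‖ := by
        rw [← key, RCLike.norm_ofReal, abs_of_nonneg (by positivity)]
    _ ≤ 1 * ‖A (Function.update z k (WithLp.toLp (p k) fun j => u j * c k j))‖ :=
        φ.le_of_opNorm_le hφ _
    _ ≤ 1 * (‖A‖ * ∏ l, ‖Function.update z k (WithLp.toLp (p k) fun j => u j * c k j) l‖) := by
        gcongr; exact A.le_opNorm _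
    _ ≤ 1 * (‖A‖ * 1) := by
        gcongr
        exact Finset.prod_le_one (fun _ _ => norm_nonneg _) fun l _ => hnorm l
    _ = ‖A‖ := by ring

end Multilinear

/-! ### The weighted mixed (r, 2) inequality -/

theorem sum_rpow_mean_le {α κ : Type*} [Fintype α] [Fintype κ] [Nonempty α] {g : α → κ → ℝ}
    (hg : ∀ a c, 0 ≤ g a c) {r B : ℝ} (hr : 1 ≤ r)
    (h : ∀ a, ∑ c, g a c ^ r ≤ B) :
    ∑ c, ((∑ a, g a c) / Fintype.card α) ^ r ≤ B := by
  have hM : (0 : ℝ) < Fintype.card α := by exact_mod_cast Fintype.card_pos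
  calc ∑ c, ((∑ a, g a c) / Fintype.card α) ^ r
      = ∑ c, (∑ a, 1 / (Fintype.card α : ℝ) * g a c) ^ r := by
        refine Finset.sum_congr rfl fun c _ => ?_
        rw [← Finset.mul_sum, one_div_mul_eq_div]
    _ ≤ ∑ c, ∑ a, 1 / (Fintype.card α : ℝ) * g a c ^ r := Finset.sum_le_sum fun c _ =>
        Real.rpow_arith_mean_le_arith_mean_rpow _ _ _ (fun _ _ => by positivity)
          (by simp [hM.ne']) (fun a _ => hg a c) hr
    _ = ∑ a, 1 / (Fintype.card α : ℝ) * ∑ c, g a c ^ r := by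
        rw [Finset.sum_comm]; simp_rw [Finset.mul_sum]
    _ ≤ ∑ _a : α, 1 / (Fintype.card α : ℝ) * B := by
        gcongr with a; exact h a
    _ = B := by simp [hM.ne']

/-- The mixed `(r, 2)` inequality for the coefficients of `vA`, multiplied by elements of the
unit balls of the spaces `ℓ_{p l}`. -/
theorem sum_weighted_coeff_rpow_le {𝕜 : Type*} [RCLike 𝕜]
    {X : Type*} [NormedAddCommGroup X] [NormedSpace 𝕜 X]
    {Y : Type*} [NormedAddCommGroup Y] [NormedSpace 𝕜 Y]
    {C D r : ℝ} (hC : IsCotypeTwoConst Y C) (hr : 1 ≤ r) {m n : ℕ}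
    {p : Fin (m + 1) → ℝ≥0∞} [∀ k, Fact (1 ≤ p k)]
    (A : ContinuousMultilinearMap 𝕜 (fun k : Fin (m + 1) => PiLp (p k) (fun _ : Fin n => 𝕜)) X)
    {v : X →L[𝕜] Y} (hD : IsSummingConst r v D) (w : Fin (m + 1) → Fin n → ℝ)
    (hw : ∀ l, ‖WithLp.toLp (p l) (w l)‖ ≤ 1) (k : Fin (m + 1)) :
    ∑ j : Fin n, (∑ i : Fin (m + 1) → Fin n with i k = j,
      (∏ l, w l (i l) ^ 2) * ‖v (A (fun l => stdBasisVec 𝕜 (p l) (i l)))‖ ^ 2) ^ (r / 2) ≤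
      ((√2 * C) ^ m * D * ‖A‖) ^ r := by
  let _ : NormedSpace ℝ Y := NormedSpace.restrictScalars ℝ 𝕜 Y
  have hr0 : 0 < r := by linarith
  have hK : 0 ≤ (√2 * C) ^ m := pow_nonneg (mul_nonneg (Real.sqrt_nonneg _) hC.1) _
  set f : (Fin (m + 1) → Fin n) → Y := fun i =>
    (∏ l, (w l (i l) : 𝕜)) • v (A (fun l => stdBasisVec 𝕜 (p l) (i l))) with hf
  -- Signed weights; coordinate k carries the trivial sign, since its index is handled by the
  -- summing property of v.
  set c : (Fin m → Fin n → ℤˣ) → Fin (m + 1) → Fin n → 𝕜 := fun ε l i =>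
    (((k.insertNth (fun _ => 1) ε : Fin (m + 1) → Fin n → ℤˣ) l i : ℤ) : 𝕜) * (w l i : 𝕜)
    with hcdef
  set x : (Fin m → Fin n → ℤˣ) → Fin n → X := fun ε j =>
    A (Function.update (fun l => WithLp.toLp (p l) (c ε l)) k
      (c ε k j • stdBasisVec 𝕜 (p k) j)) with hx
  have hc : ∀ ε l, ‖WithLp.toLp (p l) (c ε l)‖ ≤ 1 := by
    intro ε l
    refine le_of_eq_of_le (PiLp.norm_toLp_congr (p l) fun i => ?_) (hw l)
    rcases Int.units_eq_one_or ((k.insertNth (fun _ => 1) ε : Fin (m + 1) → Fin n → ℤˣ) l i)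
      with h | h <;> simp [hcdef, h]
  have hxf : ∀ ε j, ∑ i : Fin m → Fin n, (∏ l, ε l (i l)) • f (k.insertNth j i) = v (x ε j) := by
    intro ε j
    have e : (Function.update (fun l => WithLp.toLp (p l) (c ε l)) k
        (c ε k j • stdBasisVec 𝕜 (p k) j)) =
        fun l => WithLp.toLp (p l) (Function.update (c ε) k (Pi.single j (c ε k j)) l) := by
      funext l
      by_cases h : l = k
      · subst h
        ext i
        simp [stdBasisVec, Pi.single_apply]
      · simp [h]
    rw [hx]
    simp only [e]
    rw [map_toLp_eq_sum, ← Equiv.sum_comp (Fin.insertNthEquiv (fun _ => Fin n) k),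
      Fintype.sum_prod_type, Finset.sum_eq_single j, map_sum]
    · refine Finset.sum_congr rfl fun i _ => ?_
      simp only [hf, Fin.prod_univ_succAbove _ k, Fin.insertNthEquiv_apply, map_smul,
        Fin.insertNth_apply_same, Fin.insertNth_apply_succAbove, Function.update_self,
        Pi.single_eq_same, hcdef, ne_eq, Fin.succAbove_ne, not_false_eq_true,
        Function.update_of_ne, Finset.prod_mul_distrib]
      rw [Units.smul_def, ← Int.cast_smul_eq_zsmul 𝕜, smul_smul]
      push_cast
      congr 1
      ring
    · intro b _ hb
      refine Finset.sum_eq_zero fun i _ => ?_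
      simp [Fin.prod_univ_succAbove _ k, hb]
    · simp
  have hsum : ∀ ε, ∑ j, ‖v (x ε j)‖ ^ r ≤ (D * ‖A‖) ^ r := by
    intro ε
    have h1 := (hD.2 n (x ε)).trans
      (mul_le_mul_of_nonneg_left (weakL1Norm_update_le A (c ε) (hc ε) k) hD.1)
    have h0 : 0 ≤ ∑ j, ‖v (x ε j)‖ ^ r := by positivity
    have := Real.rpow_le_rpow (Real.rpow_nonneg h0 _) h1 hr0.le
    rwa [← Real.rpow_mul h0, one_div_mul_cancel hr0.ne', Real.rpow_one] at this
  -- Jensen's inequality for x ↦ x^r replaces each choice of signs by the average over all of them.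
  have hmean := sum_rpow_mean_le (fun ε j => norm_nonneg (v (x ε j))) hr hsum
  have hcard : (Fintype.card (Fin m → Fin n → ℤˣ) : ℝ) = (2 ^ n) ^ m := by simp
  rw [hcard] at hmean
  have hj : ∀ j : Fin n, (∑ i : Fin (m + 1) → Fin n with i k = j,
      (∏ l, w l (i l) ^ 2) * ‖v (A (fun l => stdBasisVec 𝕜 (p l) (i l)))‖ ^ 2) ^ (r / 2) ≤
      ((√2 * C) ^ m) ^ r *
        ((∑ ε : Fin m → Fin n → ℤˣ, ‖v (x ε j)‖) / (2 ^ n) ^ m) ^ r := by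
    intro j
    have h1 := hC.sqrt_sum_pi_le fun i : Fin m → Fin n => f (k.insertNth j i)
    simp_rw [hxf] at h1
    have h2 : ∑ i : Fin (m + 1) → Fin n with i k = j,
        (∏ l, w l (i l) ^ 2) * ‖v (A (fun l => stdBasisVec 𝕜 (p l) (i l)))‖ ^ 2 =
        ∑ i : Fin m → Fin n, ‖f (k.insertNth j i)‖ ^ 2 := by
      rw [sum_filter_eq_sum_insertNth]
      refine Finset.sum_congr rfl fun i _ => ?_
      simp only [hf, norm_smul, mul_pow, norm_prod, RCLike.norm_ofReal, ← Finset.prod_pow, sq_abs]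
    rw [h2, ← Real.mul_rpow hK (by positivity)]
    refine le_of_eq_of_le ?_ (Real.rpow_le_rpow (Real.sqrt_nonneg _) h1 hr0.le)
    rw [Real.sqrt_eq_rpow, ← Real.rpow_mul (by positivity)]
    congr 1; ring
  calc _ ≤ _ := Finset.sum_le_sum fun j _ => hj j
    _ ≤ ((√2 * C) ^ m) ^ r * (D * ‖A‖) ^ r := by
        rw [← Finset.mul_sum]
        exact mul_le_mul_of_nonneg_left hmean (Real.rpow_nonneg hK _)
    _ = _ := by
        rw [← Real.mul_rpow hK (mul_nonneg hD.1 (norm_nonneg _)), mul_assoc]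

/-! ### Trading multipliers for larger exponents -/

/-- Removal of multipliers from `ℓ_q` acting on the coordinate `l` of an array. -/
theorem sum_filter_rpow_le_of_multipliers {m n : ℕ} {W : (Fin m → Fin n) → ℝ} (hW : ∀ i, 0 ≤ W i)
    {s t q C : ℝ} (hs : 0 < s) (hq : 0 < q) (ht : 0 < t)
    (hst : 1 / t = 1 / s - 1 / q) (hC : 0 ≤ C) (l : Fin m)
    (h : ∀ u : Fin n → ℝ, (∀ c, 0 ≤ u c) → ∑ c, u c ^ q ≤ 1 →
      ∀ k, ∑ j, (∑ i with i k = j, u (i l) ^ 2 * W i) ^ (s / 2) ≤ C ^ s)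
    (k : Fin m) (hk : t ≤ 2 ∨ k = l) :
    ∑ j, (∑ i with i k = j, W i) ^ (t / 2) ≤ C ^ t := by
  have hout : ∀ u : Fin n → ℝ, (∀ c, 0 ≤ u c) → ∑ c, u c ^ q ≤ 1 →
      ∑ c, (u c ^ 2 * ∑ i with i l = c, W i) ^ (s / 2) ≤ C ^ s := by
    intro u hu huq
    refine le_of_eq_of_le (Finset.sum_congr rfl fun c _ => ?_) (h u hu huq l)
    rw [Finset.mul_sum]
    congr 1
    refine Finset.sum_congr rfl fun i hi => ?_
    rw [(Finset.mem_filter.1 hi).2]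
  have hV0 : ∀ c, 0 ≤ ∑ i with i l = c, W i := fun c => Finset.sum_nonneg fun i _ => hW i
  -- If k = l, the multiplier is constant on each inner sum and factors out, so t ≤ 2 is not needed.
  by_cases hkl : k = l
  · subst hkl
    have := sum_rpow_le_of_multipliers (V := fun c => (∑ i with i k = c, W i) ^ (s / 2))
      (fun c => Real.rpow_nonneg (hV0 c) _) hs hq ht hst hC (by
        intro u hu huq
        refine le_of_eq_of_le (Finset.sum_congr rfl fun c _ => ?_) (hout u hu huq)
        rw [Real.mul_rpow (sq_nonneg _) (hV0 c), ← Real.rpow_natCast, ← Real.rpow_mul (hu c)]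
        congr 2; push_cast; ring)
    refine le_of_eq_of_le (Finset.sum_congr rfl fun c _ => ?_) this
    rw [← Real.rpow_mul (hV0 c)]; congr 1; field_simp
  · have hfib : ∀ j, ∀ F : (Fin m → Fin n) → ℝ,
        ∑ c, ∑ i with i k = j ∧ i l = c, F i = ∑ i with i k = j, F i := by
      intro j F
      rw [← Finset.sum_fiberwise (Finset.univ.filter fun i => i k = j) (fun i => i l) F]
      simp_rw [Finset.filter_filter]
    have hfib' : ∀ c, ∀ F : (Fin m → Fin n) → ℝ,
        ∑ j, ∑ i with i k = j ∧ i l = c, F i = ∑ i with i l = c, F i := by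
      intro c F
      rw [← Finset.sum_fiberwise (Finset.univ.filter fun i => i l = c) (fun i => i k) F]
      simp_rw [Finset.filter_filter, and_comm]
    have := sum_rpow_sum_le_of_multipliers
      (b := fun j c => ∑ i : Fin m → Fin n with i k = j ∧ i l = c, W i)
      (fun j c => Finset.sum_nonneg fun i _ => hW i) hs hq ht (hk.resolve_right hkl) hst hC
      (by
        intro u hu huq
        refine le_of_eq_of_le (Finset.sum_congr rfl fun j _ => ?_) (h u hu huq k)
        rw [← hfib]
        congr 1
        refine Finset.sum_congr rfl fun c _ => ?_
        rw [Finset.mul_sum]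
        refine Finset.sum_congr rfl fun i hi => ?_
        rw [(Finset.mem_filter.1 hi).2.2])
      (by
        intro u hu huq
        simp_rw [hfib']
        exact hout u hu huq)
    simpa only [hfib] using this

/-- The mixed `(t, 2)` inequality with outer index `k` for the array `√a`, uniformly over
multipliers from the unit balls of `ℓ_{p l}` in the coordinates `l ∉ S`. -/
def MixedBound {m n : ℕ} (a : (Fin m → Fin n) → ℝ) (p : Fin m → ℝ≥0∞) [∀ k, Fact (1 ≤ p k)]
    (C : ℝ) (S : Finset (Fin m)) (t : ℝ) (k : Fin m) : Prop :=
  ∀ w : Fin m → Fin n → ℝ, (∀ l i, 0 ≤ w l i) → (∀ l ∈ S, ∀ i, w l i = 1) →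
    (∀ l ∉ S, ‖WithLp.toLp (p l) (w l)‖ ≤ 1) →
    ∑ j, (∑ i with i k = j, (∏ l, w l (i l) ^ 2) * a i) ^ (t / 2) ≤ C ^ t

/-- The bound at exponent s is required for every outer index: removing an inner multiplier
interpolates between the bounds with outer index k and outer index l. -/
theorem MixedBound.insert {m n : ℕ} {a : (Fin m → Fin n) → ℝ} (ha : ∀ i, 0 ≤ a i)
    {p : Fin m → ℝ≥0∞} [∀ k, Fact (1 ≤ p k)] {C : ℝ} (hC : 0 ≤ C) {S : Finset (Fin m)}
    {s t : ℝ} (hs : 0 < s) (ht : 0 < t) {l : Fin m} (hl : l ∉ S)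
    (hst : 1 / t = 1 / s - (1 / p l).toReal) (h : ∀ k, MixedBound a p C S s k)
    (k : Fin m) (hk : t ≤ 2 ∨ k = l) : MixedBound a p C (insert l S) t k := by
  intro w hw0 hw1 hwb
  have hpl : 1 ≤ p l := Fact.out
  -- For p_l = ∞ the exponent is unchanged, and the constant multiplier 1 already lies in the unit
  -- ball.
  rcases eq_or_ne (p l) ∞ with hp | hp
  · have : t = s := by
      rw [hp] at hst
      have : 1 / t = 1 / s := by simpa using hst
      simpa using this
    subst this
    refine h k w hw0 (fun l' hl' => hw1 l' (Finset.mem_insert_of_mem hl')) fun l' hl' => ?_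
    by_cases e : l' = l
    · subst e
      have hwl : w l' = fun _ => 1 := funext (hw1 l' (Finset.mem_insert_self _ _))
      rw [hwl]
      generalize p l' = P at *
      subst hp
      rw [PiLp.norm_eq_ciSup]
      exact Real.iSup_le (fun i => by simp) zero_le_one
    · exact hwb l' (by simp [e, hl'])
  · have hq : 0 < (p l).toReal := ENNReal.toReal_pos (by positivity) hp
    have hprod : ∀ (u : Fin n → ℝ) (i : Fin m → Fin n),
        ∏ l', (Function.update w l u) l' (i l') ^ 2 =
          u (i l) ^ 2 * ∏ l' ∈ Finset.univ.erase l, w l' (i l') ^ 2 := by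
      intro u i
      rw [← Finset.mul_prod_erase _ _ (Finset.mem_univ l), Function.update_self]
      congr 1
      refine Finset.prod_congr rfl fun l' hl' => ?_
      rw [Function.update_of_ne (Finset.ne_of_mem_erase hl')]
    have key := sum_filter_rpow_le_of_multipliers
      (W := fun i => (∏ l' ∈ Finset.univ.erase l, w l' (i l') ^ 2) * a i)
      (fun i => mul_nonneg (Finset.prod_nonneg fun _ _ => sq_nonneg _) (ha i)) hs hq ht
      (by simpa using hst) hC l (by
        intro u hu huq k'
        have := h k' (Function.update w l u) ?_ ?_ ?_
        · simpa only [hprod, mul_assoc] using this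
        · intro l' i
          by_cases e : l' = l
          · subst e; simpa using hu i
          · simpa [e] using hw0 l' i
        · intro l' hl' i
          have e : l' ≠ l := fun e => hl (e ▸ hl')
          rw [Function.update_of_ne e]
          exact hw1 l' (Finset.mem_insert_of_mem hl') i
        · intro l' hl'
          by_cases e : l' = l
          · subst e
            rw [Function.update_self, PiLp.norm_eq_sum hq]
            refine Real.rpow_le_one (by positivity) ?_ (by positivity)
            refine le_of_eq_of_le (Finset.sum_congr rfl fun c _ => ?_) huq
            rw [Real.norm_of_nonneg (hu c)]
          · rw [Function.update_of_ne e]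
            exact hwb l' (by simp [e, hl'])) k hk
    refine le_of_eq_of_le (Finset.sum_congr rfl fun j _ => ?_) key
    congr 1
    refine Finset.sum_congr rfl fun i _ => ?_
    rw [← Finset.mul_prod_erase _ _ (Finset.mem_univ l), hw1 l (Finset.mem_insert_self _ _)]
    simp

/-- The assumption on S keeps every intermediate reciprocal exponent at least 1/2, so each removal
is allowed for all outer indices. -/
theorem MixedBound.of_empty {m n : ℕ} {a : (Fin m → Fin n) → ℝ} (ha : ∀ i, 0 ≤ a i)
    {p : Fin m → ℝ≥0∞} [∀ k, Fact (1 ≤ p k)] {C : ℝ} (hC : 0 ≤ C) {r : ℝ}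
    (h : ∀ k, MixedBound a p C ∅ r k) (S : Finset (Fin m))
    (hS : ∑ l ∈ S, (1 / p l).toReal ≤ 1 / r - 1 / 2) (k : Fin m) :
    MixedBound a p C S (1 / (1 / r - ∑ l ∈ S, (1 / p l).toReal)) k := by
  induction S using Finset.induction_on generalizing k with
  | empty => simpa using h k
  | insert l S hl ih =>
    rw [Finset.sum_insert hl] at hS ⊢
    have h0 : 0 ≤ (1 / p l).toReal := ENNReal.toReal_nonneg
    refine MixedBound.insert ha hC (one_div_pos.2 (by linarith)) (one_div_pos.2 (by linarith)) hl
      (by rw [one_div_one_div, one_div_one_div]; ring) (ih (by linarith)) k (Or.inl ?_)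
    rw [div_le_iff₀ (by linarith)]
    linarith

theorem proposition4p1 {𝕜 : Type*} [RCLike 𝕜]
    {X : Type*} [NormedAddCommGroup X] [NormedSpace 𝕜 X] [CompleteSpace X]
    {Y : Type*} [NormedAddCommGroup Y] [NormedSpace 𝕜 Y] [CompleteSpace Y]
    (hY : HasCotypeTwo Y)
    (m n : ℕ) (hm : 1 ≤ m) (hn : 1 ≤ n) (r : ℝ) (hr : 1 ≤ r)
    (p : Fin m → ℝ≥0∞) [∀ k, Fact (1 ≤ p k)]
    (A : ContinuousMultilinearMap 𝕜 (fun k : Fin m => PiLp (p k) (fun _ : Fin n => 𝕜)) X)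
    (v : X →L[𝕜] Y) (hv : IsSumming r v)
    (hp : ∑ k, (1 / p k).toReal < 1 / r)
    (hp' : ∀ l : Fin m, ∑ k ∈ Finset.univ.erase l, (1 / p k).toReal ≤ 1 / r - 1 / 2)
    (lam : ℝ) (hlam : lam = 1 / (1 / r - ∑ k, (1 / p k).toReal))
    (k : Fin m) :
    (∑ j : Fin n,
        (∑ i : Fin m → Fin n with i k = j,
          ‖v (A (fun l => stdBasisVec 𝕜 (p l) (i l)))‖ ^ 2) ^ (lam / 2)) ^ (1 / lam)
      ≤ (Real.sqrt 2 * cotypeTwoConst Y) ^ (m - 1) * summingNorm r v * ‖A‖ := by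
  obtain ⟨m, rfl⟩ := Nat.exists_eq_add_of_le' hm
  have hC := isCotypeTwoConst_cotypeTwoConst hY
  have hD := isSummingConst_summingNorm hv
  set B : ℝ := (√2 * cotypeTwoConst Y) ^ m * summingNorm r v * ‖A‖ with hB
  have hB0 : 0 ≤ B := mul_nonneg (mul_nonneg
    (pow_nonneg (mul_nonneg (Real.sqrt_nonneg _) hC.1) _) hD.1) (norm_nonneg _)
  set a : (Fin (m + 1) → Fin n) → ℝ := fun i =>
    ‖v (A (fun l => stdBasisVec 𝕜 (p l) (i l)))‖ ^ 2 with ha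
  have ha0 : ∀ i, 0 ≤ a i := fun i => sq_nonneg _
  have hbase : ∀ k, MixedBound a p B ∅ r k := fun k w _ _ hw =>
    sum_weighted_coeff_rpow_le hC hr A hD w (fun l => hw l (Finset.notMem_empty l)) k
  have hsum := Finset.add_sum_erase Finset.univ (fun k => (1 / p k).toReal) (Finset.mem_univ k)
  have hk0 : 0 ≤ (1 / p k).toReal := ENNReal.toReal_nonneg
  have hlam0 : 0 < lam := by rw [hlam]; exact one_div_pos.2 (by linarith)
  -- The multiplier of the outer coordinate k goes last, because this removal alone may push the
  -- exponent beyond 2.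
  have hmain := MixedBound.insert ha0 hB0 (one_div_pos.2 (by linarith)) hlam0
    (Finset.notMem_erase k Finset.univ)
    (by rw [hlam, one_div_one_div, one_div_one_div, ← hsum]; ring)
    (MixedBound.of_empty ha0 hB0 hbase _ (hp' k)) k (Or.inr rfl)
  have hone := hmain (fun _ _ => 1) (fun _ _ => zero_le_one) (fun _ _ _ => rfl)
    (fun l hl => absurd (by simp [Finset.insert_erase]) hl)
  simp only [one_pow, Finset.prod_const_one, one_mul] at hone
  have h0 : 0 ≤ ∑ j : Fin n, (∑ i : Fin (m + 1) → Fin n with i k = j, a i) ^ (lam / 2) :=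
    Finset.sum_nonneg fun j _ => Real.rpow_nonneg (Finset.sum_nonneg fun i _ => ha0 i) _
  have := Real.rpow_le_rpow h0 hone (one_div_pos.2 hlam0).le
  rwa [← Real.rpow_mul hB0, mul_one_div_cancel hlam0.ne', Real.rpow_one] at this
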